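/- Let $N\ge 1$ be an integer, $\alpha\in\mathbb{Z}/N\mathbb{Z}$, $R=\mathbb{Z}[X]/(X^N-1)$, and let $\mathcal{P}(N;\alpha)$ be the set of primes $p\equiv\alpha\pmod N$. For $n\ge 1$ put \[\mathcal{A}_n(N;\alpha)=\Bigl(\prod_{p\in\mathcal{P}(N;\alpha)}R/p^nR\Bigr)\Big/\Bigl(\bigoplus_{p\in\mathcal{P}(N;\alpha)}R/p^nR\Bigr),\qquad \widehat{\mathcal{A}}(N;\alpha)=\varprojlim_n\mathcal{A}_n(N;\alpha),\] with the projective limit topology of the discrete rings $\mathcal{A}_n(N;\alpha)$, and let $\pi_N\colon\prod_{p\in\mathcal{P}(N;\alpha)}\varprojlim_n R/p^nR\to\widehat{\mathcal{A}}(N;\alpha)$ be the natural projection. The ring $\widehat{\mathcal{A}}(N;\alpha)$ is a $\mathbb{Q}$-algebra. Put $\boldsymbol{p}=\pi_N((p)_p)$. Let $\mu_N$ be the group of $N$-th roots of unity in $\mathbb{C}$, embedded in $R^\times$ by sending a fixed primitive $N$-th root of unity to the class of $X$, and put $\eta^{\boldsymbol{p}}=\pi_N((\eta^p)_p)$ for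 $\eta\in\mu_N$. For $\eta_1,\dots,\eta_r\in\mu_N$ and positive integers $k_1,\dots,k_r$ ($r\ge 0$) the $\boldsymbol{p}$-adic finite multiple $L$-value is \[L_{\widehat{\mathcal{A}},\alpha}\binom{\eta_1,\dots,\eta_r}{k_1,\dots,k_r}=\pi_N\Biggl(\Biggl(\sum_{0<n_1<\cdots<n_r<p}\frac{\eta_1^{n_1}\eta_2^{n_2-n_1}\cdots\eta_r^{n_r-n_{r-1}}}{n_1^{k_1}\cdots n_r^{k_r}}\Biggr)_{p}\Biggr)\in\widehat{\mathcal{A}}(N;\alpha).\] It is extended $\mathbb{Q}$-linearly to the $\mathbb{Q}$-vector space $\mathcal{R}_N$ with basis the tuples $\binom{\eta_1,\dots,\eta_r}{k_1,\dots,k_r}$. The shuffle product on $\mathcal{R}_N$ is $a\mathbin{\sqcup\!\sqcup} b=W^{-1}(W(a)\mathbin{\sqcup\!\sqcup} W(b))$, where $W$ is the linear bijection $\binom{\eta_1,\dots,\eta_r}{k_1,\dots,k_r}\mapsto\prod_{i=1}^r e_{\eta_i}e_0^{k_i-1}$ from $\mathcal{R}_N$ onto the span of the words in the letters $e_0$,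 $e_\eta$ ($\eta\in\mu_N$) that do not begin with $e_0$, and the shuffle product of words is the bilinear product with $1\mathbin{\sqcup\!\sqcup} w=w\mathbin{\sqcup\!\sqcup} 1=w$ and $we_z\mathbin{\sqcup\!\sqcup} w'e_{z'}=(we_z\mathbin{\sqcup\!\sqcup} w')e_{z'}+(w\mathbin{\sqcup\!\sqcup} w'e_{z'})e_z$. Then for all integers $r\ge 0$, $s\ge 1$, all positive integers $k_1,\dots,k_r,l_1,\dots,l_s$ and all $\eta_1,\dots,\eta_r,\xi_1,\dots,\xi_s\in\mu_N$, the series below converges (unconditionally) in $\widehat{\mathcal{A}}(N;\alpha)$ and \[L_{\widehat{\mathcal{A}},\alpha}\left(\binom{\eta_1,\dots,\eta_r}{k_1,\dots,k_r}\mathbin{\sqcup\!\sqcup} \binom{\xi_1,\dots,\xi_s}{l_1,\dots,l_s}\right)=(-1)^{l_1+\cdots+l_s}\,\xi_1^{\boldsymbol{p}}\sum_{f_1,\dots,f_s\ge 0}\left(\prod_{i=1}^s\binom{l_i+f_i-1}{f_i}\right)L_{\widehat{\mathcal{A}},\alpha}\binom{\eta_1/\xi_1,\dots,\eta_r/\xi_1,\,1/\xi_1,\,\xi_s/\xi_1,\dots,\xi_2/\xi_1}{k_1,\dots,k_r,\,l_s+f_s,\dots,l_1+f_1}\,\boldsymbol{p}^{f_1+\cdots+f_s}.\]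 -/

import Mathlib

noncomputable section

namespace FiniteMLV

/-! ### Adelic rings -/

section Adelic

variable {R : Type} [CommRing R] {ι : Type} (a : ι → R)

/-- The direct sum `⨁ᵢ R / aᵢⁿ R`, as an ideal of the product `∏ᵢ R / aᵢⁿ R`. -/
def directSumIdeal (n : ℕ+) : Ideal (∀ i, R ⧸ Ideal.span {a i} ^ (n : ℕ)) where
  carrier := {f | {i | f i ≠ 0}.Finite}
  zero_mem' := by simp
  add_mem' := by
    intro f g hf hg
    refine (Set.Finite.union hf hg).subset fun i hi => ?_
    by_contra h
    simp only [Set.mem_union, Set.mem_ofPred_eq, not_or, not_not] at h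
    exact hi (by simp [h.1, h.2])
  smul_mem' := by
    intro c f hf
    refine Set.Finite.subset hf fun i hi h => hi ?_
    simp [show f i = 0 from h]

/-- `𝒜ₙ = (∏ᵢ R / aᵢⁿ R) / (⨁ᵢ R / aᵢⁿ R)` for a family `a` of elements of `R`. -/
def AdelicLevel (n : ℕ+) : Type :=
  (∀ i, R ⧸ Ideal.span {a i} ^ (n : ℕ)) ⧸ directSumIdeal a n

instance (n : ℕ+) : CommRing (AdelicLevel a n) :=
  inferInstanceAs (CommRing (_ ⧸ directSumIdeal a n))

instance (n : ℕ+) : TopologicalSpace (AdelicLevel a n) := ⊥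

instance (n : ℕ+) : DiscreteTopology (AdelicLevel a n) := ⟨rfl⟩

/-- The class of a family in `𝒜ₙ`. -/
def levelMk (n : ℕ+) : (∀ i, R ⧸ Ideal.span {a i} ^ (n : ℕ)) →+* AdelicLevel a n :=
  Ideal.Quotient.mk (directSumIdeal a n)

/-- The natural projection `∏ᵢ R / aᵢⁿ R → ∏ᵢ R / aᵢᵐ R` for `m ≤ n`. -/
def piTransition {m n : ℕ+} (h : m ≤ n) :
    (∀ i, R ⧸ Ideal.span {a i} ^ (n : ℕ)) →+* (∀ i, R ⧸ Ideal.span {a i} ^ (m : ℕ)) :=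
  RingHom.pi fun i =>
    (Ideal.Quotient.factorPow (Ideal.span {a i}) (PNat.coe_le_coe m n |>.2 h)).comp
      (Pi.evalRingHom _ i)

/-- The natural projection `𝒜ₙ → 𝒜ₘ` for `m ≤ n`. -/
def levelTransition {m n : ℕ+} (h : m ≤ n) : AdelicLevel a n →+* AdelicLevel a m :=
  Ideal.Quotient.lift (directSumIdeal a n) ((levelMk a m).comp (piTransition a h)) (by
    intro f hf
    refine Ideal.Quotient.eq_zero_iff_mem.2 (Set.Finite.subset hf fun i hi h0 => hi ?_)
    change Ideal.Quotient.factorPow _ (PNat.coe_le_coe m n |>.2 h) (f i) = 0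
    rw [show f i = 0 from h0, map_zero])

/-- `𝒜̂ = lim 𝒜ₙ`, with the projective limit topology (subspace topology of the product of the
discrete rings `𝒜ₙ`). -/
def AdelicHat : Subring (∀ n : ℕ+, AdelicLevel a n) where
  carrier := {x | ∀ (m n : ℕ+) (h : m ≤ n), levelTransition a h (x n) = x m}
  zero_mem' := by intro m n h; simp
  one_mem' := by intro m n h; simp
  add_mem' := by intro x y hx hy m n h; simp [hx m n h, hy m n h]
  mul_mem' := by intro x y hx hy m n h; simp [hx m n h, hy m n h]
  neg_mem' := by intro x hx m n h; simp [hx m n h]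

/-- The natural projection `π : ∏ᵢ (lim R / aᵢⁿ R) → 𝒜̂`. -/
def toHat : (∀ i, AdicCompletion (Ideal.span {a i}) R) →+* AdelicHat a :=
  RingHom.codRestrict
    (RingHom.pi fun n : ℕ+ => (levelMk a n).comp <| RingHom.pi fun i =>
      ((AdicCompletion.evalₐ (Ideal.span {a i}) (n : ℕ)).toRingHom).comp (Pi.evalRingHom _ i))
    (AdelicHat a) (by
      intro x m n h
      refine congrArg (levelMk a m) (funext fun i => ?_)
      have h' : (m : ℕ) ≤ n := PNat.coe_le_coe m n |>.2 h
      obtain ⟨y, hy⟩ := AdicCompletion.mk_surjective (Ideal.span {a i}) R (x i)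
      change Ideal.Quotient.factorPow _ h' (AdicCompletion.evalₐ _ _ (x i)) =
        AdicCompletion.evalₐ _ _ (x i)
      rw [← hy, AdicCompletion.evalₐ_mk, AdicCompletion.evalₐ_mk]
      exact AdicCompletion.Ideal.mk_eq_mk (Ideal.span {a i}) h' y)

/-- `𝒜̂` is a Hausdorff space, so that the sum of a series in it is unique. -/
instance : T2Space (AdelicHat a) := inferInstance

end Adelic

/-! ### The ring `𝒜̂(N;α)` -/

/-- `ℤ[X] / (X^N - 1)`. -/
abbrev CycRing (N : ℕ) : Type := AdjoinRoot (Polynomial.X ^ N - 1 : Polynomial ℤ)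

/-- The primes congruent to `α` modulo `N`. -/
abbrev PrimesMod (N : ℕ) (α : ZMod N) : Type := {p : ℕ // p.Prime ∧ (p : ZMod N) = α}

/-- The family of the primes `p ≡ α (mod N)`, as elements of `ℤ[X] / (X^N - 1)`. -/
abbrev primeFamily (N : ℕ) (α : ZMod N) : PrimesMod N α → CycRing N := fun p => (p.1 : CycRing N)

/-- `𝒜̂(N;α)`. -/
abbrev AHat (N : ℕ) (α : ZMod N) : Type := AdelicHat (primeFamily N α)

/-- `lim R / pⁿ R` for `R = ℤ[X] / (X^N - 1)`. -/
abbrev PAdic (N : ℕ) (p : ℕ) : Type :=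
  AdicCompletion (Ideal.span {(p : CycRing N)}) (CycRing N)

/-- The natural projection onto `𝒜̂(N;α)`. -/
def proj (N : ℕ) (α : ZMod N) : (∀ p : PrimesMod N α, PAdic N p.1) →+* AHat N α :=
  toHat (primeFamily N α)

/-- The infinitely large prime `𝐩 = π((p)ₚ)`. -/
def bigPrime (N : ℕ) (α : ZMod N) : AHat N α := proj N α fun p => (p.1 : PAdic N p.1)

/-- The integers prime to `p` are invertible in `lim R / pⁿ R`. -/
theorem isUnit_natCast_padic (N p n : ℕ) (h : n.Coprime p) : IsUnit (n : PAdic N p) := by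
  have hc := AdicCompletion.isAdicComplete_self (Ideal.span {(p : CycRing N)})
    (Submodule.fg_span_singleton _)
  have hp : (p : PAdic N p) ∈ (⊥ : Ideal (PAdic N p)).jacobson := by
    refine IsAdicComplete.le_jacobson_bot ((Ideal.span {(p : CycRing N)}).map
      (algebraMap (CycRing N) (PAdic N p))) ?_
    simpa using Ideal.mem_map_of_mem (algebraMap (CycRing N) (PAdic N p))
      (Ideal.mem_span_singleton_self (p : CycRing N))
  have hb : (n : ℤ) * n.gcdA p + p * n.gcdB p = 1 := by
    rw [← Nat.gcd_eq_gcd_ab, h.gcd_eq_one, Nat.cast_one]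
  have hb' : (n : PAdic N p) * (n.gcdA p : ℤ) = (p : PAdic N p) * (-(n.gcdB p : ℤ) : ℤ) + 1 := by
    have := congrArg (Int.cast : ℤ → PAdic N p) hb
    push_cast at this ⊢
    linear_combination this
  exact isUnit_of_mul_isUnit_left (hb' ▸ Ideal.mem_jacobson_bot.1 hp _)

/-- Every nonzero integer is invertible in `𝒜̂(N;α)`. -/
theorem isUnit_intCast_hat (N : ℕ) (α : ZMod N) (d : ℤ) (hd : d ≠ 0) :
    IsUnit (d : AHat N α) := by
  have key : ∀ n : ℕ+, ∃ y : AdelicLevel (primeFamily N α) n, (d : AdelicLevel _ n) * y = 1 := by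
    intro n
    refine ⟨levelMk _ n fun p => Ring.inverse (d : CycRing N ⧸ _), ?_⟩
    rw [← map_intCast (levelMk (primeFamily N α) n), ← map_mul, ← map_one (levelMk _ n)]
    refine Ideal.Quotient.eq.2 (Set.Finite.subset (s := {p | p.1 ∣ d.natAbs}) ?_ fun p hp => ?_)
    · exact Set.Finite.of_injOn (f := Subtype.val) (t := (d.natAbs.divisors : Set ℕ))
        (fun p hp => by simpa [hd] using hp) Subtype.val_injective.injOn (Finset.finite_toSet _)
    · by_contra hpd
      refine hp (sub_eq_zero.2 (Ring.mul_inverse_cancel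
        ((d : ∀ q : PrimesMod N α, CycRing N ⧸ Ideal.span {primeFamily N α q} ^ (n : ℕ)) p) ?_))
      have hu : IsUnit ((d.natAbs : ℕ) : CycRing N ⧸ Ideal.span {primeFamily N α p} ^ (n : ℕ)) := by
        have := (isUnit_natCast_padic N p.1 d.natAbs
          ((Nat.Prime.coprime_iff_not_dvd p.2.1).2 hpd).symm).map
            (AdicCompletion.evalₐ (Ideal.span {(p.1 : CycRing N)}) (n : ℕ))
        simpa using this
      rcases Int.natAbs_eq d with h | h
      · rw [Pi.intCast_apply, h, Int.cast_natCast]; exact hu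
      · rw [Pi.intCast_apply, h, Int.cast_neg, Int.cast_natCast]; exact hu.neg
  choose y hy using key
  refine IsUnit.of_mul_eq_one ⟨y, fun m n h => ?_⟩ (Subtype.ext (funext hy))
  have h1 := congrArg (levelTransition (primeFamily N α) h) (hy n)
  rw [map_mul, map_intCast, map_one] at h1
  calc levelTransition _ h (y n) = (d * y m) * levelTransition _ h (y n) := by rw [hy m, one_mul]
    _ = y m * (d * levelTransition _ h (y n)) := by ring
    _ = y m := by rw [h1, mul_one]

/-- The canonical `ℚ`-algebra structure of `𝒜̂(N;α)`. -/
instance (N : ℕ) (α : ZMod N) : Algebra ℚ (AHat N α) :=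
  (IsLocalization.lift (M := nonZeroDivisors ℤ) (S := ℚ) (g := Int.castRingHom (AHat N α))
    fun d => isUnit_intCast_hat N α d (nonZeroDivisors.ne_zero d.2)).toAlgebra

/-! ### Roots of unity -/

/-- The class of `X`, as a unit of `ℤ[X] / (X^N - 1)`. -/
def xUnit (N : ℕ) [NeZero N] : (CycRing N)ˣ :=
  Units.ofPowEqOne (AdjoinRoot.root (Polynomial.X ^ N - 1 : Polynomial ℤ)) N
    (by
      have h := AdjoinRoot.eval₂_root (Polynomial.X ^ N - 1 : Polynomial ℤ)
      simpa [sub_eq_zero] using h)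
    (NeZero.ne N)

/-- The identification of the group `μ_N` of complex `N`-th roots of unity with the group of the
classes of the powers of `X` in `ℤ[X] / (X^N - 1)` that sends the primitive root `ζ` to `X`. -/
def muHom (N : ℕ) [NeZero N] (ζ : rootsOfUnity N ℂ) (hζ : IsPrimitiveRoot ζ N) :
    rootsOfUnity N ℂ →* (CycRing N)ˣ :=
  monoidHomOfForallMemZpowers (g := ζ) (g' := xUnit N)
    (by
      intro x
      have h : (x : ℂˣ) ∈ Subgroup.zpowers (ζ : ℂˣ) := by
        rw [IsPrimitiveRoot.zpowers_eq (IsPrimitiveRoot.coe_submonoidClass_iff.2 hζ)]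
        exact x.2
      obtain ⟨i, hi⟩ := h
      exact ⟨i, Subtype.ext (by simpa using hi)⟩)
    (by
      rw [← hζ.eq_orderOf]
      exact orderOf_dvd_of_pow_eq_one (Units.pow_ofPowEqOne _ _))

/-! ### Words, indices and the shuffle product -/

section Shuffle

variable {D : Type}

/-- The basis of `ℚ⟨e_z ∣ z ∈ D⟩` formed by the words. -/
abbrev wordBasis (D : Type) : Module.Basis (FreeMonoid D) ℚ (FreeAlgebra ℚ D) :=
  FreeAlgebra.basisFreeMonoid ℚ D

/-- The shuffle product of two words, each given by the list of its letters from the last one to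
the first one:
`1 ш w = w ш 1 = w` and `w e_z ш w' e_z' = (w e_z ш w') e_z' + (w ш w' e_z') e_z`. -/
def shuffleRev : List D → List D → FreeAlgebra ℚ D
  | [], v => (v.reverse.map (FreeAlgebra.ι ℚ)).prod
  | z :: u, [] => ((z :: u).reverse.map (FreeAlgebra.ι ℚ)).prod
  | z :: u, z' :: v =>
      shuffleRev (z :: u) v * FreeAlgebra.ι ℚ z' + shuffleRev u (z' :: v) * FreeAlgebra.ι ℚ z
  termination_by u v => u.length + v.length

/-- The shuffle product on `ℚ⟨e_z ∣ z ∈ D⟩`. -/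
def shuffle : FreeAlgebra ℚ D →ₗ[ℚ] FreeAlgebra ℚ D →ₗ[ℚ] FreeAlgebra ℚ D :=
  (wordBasis D).constr ℚ fun u => (wordBasis D).constr ℚ fun v =>
    shuffleRev (FreeMonoid.toList u).reverse (FreeMonoid.toList v).reverse

variable (μ : Type)

/-- Tuples `(a₁, …, a_r; k₁, …, k_r)` with `aᵢ ∈ μ` and `kᵢ` positive integers, `r ≥ 0`. -/
abbrev Index : Type := List (μ × ℕ+)

/-- The `ℚ`-vector space with basis the tuples `(a₁, …, a_r; k₁, …, k_r)`. -/
abbrev IndexSpace : Type := Index μ →₀ ℚ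

variable {μ}

/-- The word `∏ᵢ e_{aᵢ} e_0^{kᵢ - 1}`, with the letters `e_0` and `e_a`, `a ∈ μ`. -/
def indexWord (t : Index μ) : FreeAlgebra ℚ (WithZero μ) :=
  (t.map fun c => FreeAlgebra.ι ℚ (c.1 : WithZero μ) *
    FreeAlgebra.ι ℚ (0 : WithZero μ) ^ ((c.2 : ℕ) - 1)).prod

/-- `W`, the `ℚ`-linear extension of `indexWord`. -/
def toWords : IndexSpace μ →ₗ[ℚ] FreeAlgebra ℚ (WithZero μ) :=
  Finsupp.linearCombination ℚ indexWord

/-- Decomposition of a list of letters as `m` letters `0`, followed by the letters of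
`∏ᵢ e_{aᵢ} e_0^{kᵢ - 1}`. -/
def parse : List (WithZero μ) → ℕ × Index μ
  | [] => (0, [])
  | none :: w => ((parse w).1 + 1, (parse w).2)
  | some c :: w => (0, (c, (parse w).1.succPNat) :: (parse w).2)

/-- `W⁻¹`, extended by `0` to the words that begin with `e_0`. -/
def ofWords : FreeAlgebra ℚ (WithZero μ) →ₗ[ℚ] IndexSpace μ :=
  (wordBasis (WithZero μ)).constr ℚ fun w =>
    if (parse (FreeMonoid.toList w)).1 = 0
    then Finsupp.single (parse (FreeMonoid.toList w)).2 1 else 0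

/-- The shuffle product `a ш b = W⁻¹(W(a) ш W(b))` of tuples. -/
def indexShuffle (x y : IndexSpace μ) : IndexSpace μ :=
  ofWords (shuffle (toWords x) (toWords y))

/-! The defining rules of the shuffle product, and `W⁻¹ ∘ W = id`. -/

theorem wordBasis_apply (w : List D) :
    wordBasis D (FreeMonoid.ofList w) = (w.map (FreeAlgebra.ι ℚ)).prod := by
  simp [wordBasis, FreeAlgebra.basisFreeMonoid, FreeAlgebra.equivMonoidAlgebraFreeMonoid,
    FreeMonoid.lift_apply]

theorem shuffle_words (u v : List D) :
    shuffle (u.map (FreeAlgebra.ι ℚ)).prod (v.map (FreeAlgebra.ι ℚ)).prod =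
      shuffleRev u.reverse v.reverse := by
  rw [← wordBasis_apply, ← wordBasis_apply, shuffle, Module.Basis.constr_basis,
    Module.Basis.constr_basis]
  rfl

/-- `1 ш w = w`. -/
theorem one_shuffle (w : FreeAlgebra ℚ D) : shuffle 1 w = w := by
  suffices h : shuffle (1 : FreeAlgebra ℚ D) = LinearMap.id from by rw [h]; rfl
  refine (wordBasis D).ext fun v => ?_
  have h := shuffle_words ([] : List D) (FreeMonoid.toList v)
  rw [← wordBasis_apply v.toList] at h
  simpa [shuffleRev, ← wordBasis_apply] using h

theorem word_induction {P : FreeAlgebra ℚ D → Prop} (w : FreeAlgebra ℚ D)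
    (hw : ∀ u : List D, P (u.map (FreeAlgebra.ι ℚ)).prod) (h0 : P 0)
    (ha : ∀ a b, P a → P b → P (a + b)) (hs : ∀ (c : ℚ) a, P a → P (c • a)) : P w := by
  have hm : w ∈ Submodule.span ℚ (Set.range (wordBasis D)) := by
    rw [(wordBasis D).span_eq]; trivial
  induction hm using Submodule.span_induction with
  | mem x hx =>
    obtain ⟨u, rfl⟩ := hx
    have := hw u.toList
    rwa [← wordBasis_apply] at this
  | zero => exact h0
  | add a b _ _ h1 h2 => exact ha a b h1 h2
  | smul c a _ h1 => exact hs c a h1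

/-- `w ш 1 = w`. -/
theorem shuffle_one (w : FreeAlgebra ℚ D) : shuffle w 1 = w := by
  have h2 : ∀ u : List D, shuffleRev u [] = (u.reverse.map (FreeAlgebra.ι ℚ)).prod := by
    rintro (_ | ⟨a, u⟩) <;> simp [shuffleRev]
  refine word_induction (P := fun w => shuffle w 1 = w) w (fun u => ?_) (by simp)
    (fun a b ha hb => by simp [ha, hb])
    (fun c a ha => by simp [ha])
  have h := shuffle_words u ([] : List D)
  simpa [h2] using h

/-- `w e_z ш w' e_z' = (w e_z ш w') e_z' + (w ш w' e_z') e_z`. -/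
theorem shuffle_mul_letter (w w' : FreeAlgebra ℚ D) (z z' : D) :
    shuffle (w * FreeAlgebra.ι ℚ z) (w' * FreeAlgebra.ι ℚ z') =
      shuffle (w * FreeAlgebra.ι ℚ z) w' * FreeAlgebra.ι ℚ z' +
        shuffle w (w' * FreeAlgebra.ι ℚ z') * FreeAlgebra.ι ℚ z := by
  refine word_induction (P := fun w => shuffle (w * FreeAlgebra.ι ℚ z) (w' * FreeAlgebra.ι ℚ z') =
      shuffle (w * FreeAlgebra.ι ℚ z) w' * FreeAlgebra.ι ℚ z' +
        shuffle w (w' * FreeAlgebra.ι ℚ z') * FreeAlgebra.ι ℚ z) w (fun u => ?_) (by simp)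
    (fun a b ha hb => by simp only [add_mul, map_add, LinearMap.add_apply, ha, hb]; abel)
    (fun c a ha => by simp only [smul_mul_assoc, map_smul, LinearMap.smul_apply, ha, smul_add])
  obtain ⟨x, hx⟩ : ∃ x, x = (u.map (FreeAlgebra.ι ℚ)).prod := ⟨_, rfl⟩
  rw [← hx]
  refine word_induction (P := fun w' => shuffle (x * FreeAlgebra.ι ℚ z) (w' * FreeAlgebra.ι ℚ z') =
      shuffle (x * FreeAlgebra.ι ℚ z) w' * FreeAlgebra.ι ℚ z' +
        shuffle x (w' * FreeAlgebra.ι ℚ z') * FreeAlgebra.ι ℚ z) w' (fun v => ?_) (by simp)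
    (fun a b ha hb => by simp only [add_mul, map_add, ha, hb]; abel)
    (fun c a ha => by simp only [smul_mul_assoc, map_smul, ha, smul_add])
  subst hx
  have e : ∀ (u : List D) (z : D), (u.map (FreeAlgebra.ι ℚ)).prod * FreeAlgebra.ι ℚ z =
      ((u ++ [z]).map (FreeAlgebra.ι ℚ)).prod := by simp
  rw [e, e, shuffle_words, shuffle_words, shuffle_words]
  simp only [List.reverse_append, List.reverse_cons, List.reverse_nil, List.nil_append,
    List.singleton_append]
  rw [shuffleRev]

/-- The letters of `indexWord`. -/
def indexLetters (t : Index μ) : List (WithZero μ) :=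
  t.flatMap fun c => (c.1 : WithZero μ) :: List.replicate ((c.2 : ℕ) - 1) 0

theorem indexWord_eq (t : Index μ) :
    indexWord t = ((indexLetters t).map (FreeAlgebra.ι ℚ)).prod := by
  induction t with
  | nil => simp [indexWord, indexLetters]
  | cons c t ih =>
    simp only [indexWord, indexLetters, List.map_cons, List.prod_cons, List.flatMap_cons,
      List.map_append, List.prod_append, List.map_replicate, List.prod_replicate] at ih ⊢
    rw [ih]

theorem parse_replicate (n : ℕ) (w : List (WithZero μ)) :
    parse (List.replicate n 0 ++ w) = ((parse w).1 + n, (parse w).2) := by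
  induction n with
  | zero => rfl
  | succ n ih =>
    rw [List.replicate_succ, List.cons_append]
    change ((parse _).1 + 1, (parse _).2) = _
    rw [ih]; rfl

theorem parse_indexLetters (t : Index μ) : parse (indexLetters t) = (0, t) := by
  induction t with
  | nil => rfl
  | cons c t ih =>
    rw [indexLetters, List.flatMap_cons, List.cons_append]
    change (0, (c.1, (parse _).1.succPNat) :: (parse _).2) = _
    rw [parse_replicate]
    change (0, (c.1, ((parse (indexLetters t)).1 + _).succPNat) :: (parse (indexLetters t)).2) = _
    rw [ih]
    have : (0 + ((c.2 : ℕ) - 1)).succPNat = c.2 := by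
      apply PNat.coe_injective; have := c.2.pos; simp only [Nat.succPNat_coe]; omega
    rw [this]

theorem indexLetters_parse (w : List (WithZero μ)) :
    List.replicate (parse w).1 0 ++ indexLetters (parse w).2 = w := by
  induction w with
  | nil => rfl
  | cons c w ih =>
    cases c with
    | zero =>
      change List.replicate ((parse w).1 + 1) 0 ++ indexLetters (parse w).2 = _
      rw [List.replicate_succ, List.cons_append, ih]
    | coe c =>
      change indexLetters ((c, (parse w).1.succPNat) :: (parse w).2) = _
      rw [indexLetters, List.flatMap_cons, List.cons_append]
      change _ :: (List.replicate (parse w).1 0 ++ indexLetters (parse w).2) = _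
      rw [ih]

/-- `ofWords` is a left inverse of `W`. -/
theorem ofWords_toWords (x : IndexSpace μ) : ofWords (toWords x) = x := by
  suffices h : ofWords ∘ₗ toWords = (LinearMap.id : IndexSpace μ →ₗ[ℚ] _) from
    LinearMap.congr_fun h x
  ext1 t
  ext1
  simp only [LinearMap.comp_apply, Finsupp.lsingle_apply, LinearMap.id_apply, toWords,
    Finsupp.linearCombination_single, one_smul]
  rw [indexWord_eq, ← wordBasis_apply, ofWords, Module.Basis.constr_basis, FreeMonoid.toList_ofList,
    parse_indexLetters]
  simp

theorem toWords_ofWords_word (w : List (WithZero μ)) (hw : w.head? ≠ some 0) :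
    toWords (ofWords (w.map (FreeAlgebra.ι ℚ)).prod) = (w.map (FreeAlgebra.ι ℚ)).prod := by
  have h := indexLetters_parse w
  have h0 : (parse w).1 = 0 := by
    by_contra hne
    obtain ⟨n, hn⟩ := Nat.exists_eq_succ_of_ne_zero hne
    rw [hn, List.replicate_succ, List.cons_append] at h
    rw [← h] at hw; simp at hw
  rw [← wordBasis_apply, ofWords, Module.Basis.constr_basis, FreeMonoid.toList_ofList, if_pos h0,
    toWords, Finsupp.linearCombination_single, one_smul, indexWord_eq, wordBasis_apply]
  rw [h0] at h
  simpa using congrArg (fun w => (List.map (FreeAlgebra.ι ℚ) w).prod) h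

theorem shuffleRev_mem (u v : List (WithZero μ)) (hu : u.getLast? ≠ some 0)
    (hv : v.getLast? ≠ some 0) :
    shuffleRev u v ∈ Submodule.span ℚ {x | ∃ w : List (WithZero μ), w.head? ≠ some 0 ∧
      (w = [] → u = [] ∧ v = []) ∧ x = (w.map (FreeAlgebra.ι ℚ)).prod} := by
  have step : ∀ (P : Prop) (y : FreeAlgebra ℚ (WithZero μ)) (z : WithZero μ), ¬ P →
      y ∈ Submodule.span ℚ {x | ∃ w : List (WithZero μ), w.head? ≠ some 0 ∧
      (w = [] → P) ∧ x = (w.map (FreeAlgebra.ι ℚ)).prod} → ∀ Q : Prop,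
      y * FreeAlgebra.ι ℚ z ∈ Submodule.span ℚ {x | ∃ w : List (WithZero μ), w.head? ≠ some 0 ∧
      (w = [] → Q) ∧ x = (w.map (FreeAlgebra.ι ℚ)).prod} := by
    intro P y z hP hy Q
    induction hy using Submodule.span_induction with
    | mem x hx =>
      obtain ⟨w, h1, h2, rfl⟩ := hx
      have hw : w ≠ [] := fun h => hP (h2 h)
      refine Submodule.subset_span ⟨w ++ [z], ?_, by simp, by simp⟩
      rwa [List.head?_append_of_ne_nil _ hw]
    | zero => simp
    | add a b _ _ h1 h2 => rw [add_mul]; exact Submodule.add_mem _ h1 h2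
    | smul c a _ h1 => rw [smul_mul_assoc]; exact Submodule.smul_mem _ _ h1
  induction u, v using shuffleRev.induct with
  | case1 v =>
    refine Submodule.subset_span ⟨v.reverse, by simpa using hv, by simp, by simp [shuffleRev]⟩
  | case2 z u =>
    refine Submodule.subset_span ⟨(z :: u).reverse, by rwa [List.head?_reverse],
      by simp, by simp [shuffleRev]⟩
  | case3 z u z' v ih1 ih2 =>
    have tl : ∀ (z : WithZero μ) u, (z :: u).getLast? ≠ some 0 → u.getLast? ≠ some 0 := by
      intro z u h; cases u with
      | nil => simp
      | cons b u => simpa using h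
    rw [shuffleRev]
    exact Submodule.add_mem _ (step _ _ _ (by simp) (ih1 hu (tl _ _ hv)) _)
      (step _ _ _ (by simp) (ih2 (tl _ _ hu) hv) _)

/-- `W(a ш b) = W(a) ш W(b)`: the words that begin with `e_0` play no role in `indexShuffle`. -/
theorem toWords_indexShuffle (x y : IndexSpace μ) :
    toWords (indexShuffle x y) = shuffle (toWords x) (toWords y) := by
  have hh : ∀ t : Index μ, (indexLetters t).head? ≠ some 0 := by
    rintro (_ | ⟨c, t⟩) <;> simp [indexLetters]
  have main : ∀ t t' : Index μ, toWords (ofWords (shuffle (indexWord t) (indexWord t'))) =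
      shuffle (indexWord t) (indexWord t') := by
    intro t t'
    rw [indexWord_eq, indexWord_eq, shuffle_words]
    have h := shuffleRev_mem (indexLetters t).reverse (indexLetters t').reverse
      (by simpa using hh t) (by simpa using hh t')
    generalize shuffleRev (indexLetters t).reverse (indexLetters t').reverse = q at h ⊢
    induction h using Submodule.span_induction with
    | mem x hx =>
      obtain ⟨w, h1, -, rfl⟩ := hx
      exact toWords_ofWords_word w h1
    | zero => simp
    | add a b _ _ h1 h2 => rw [map_add, map_add, h1, h2]
    | smul c a _ h1 => rw [map_smul, map_smul, h1]
  unfold indexShuffle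
  induction x using Finsupp.induction_linear with
  | zero => simp
  | add a b ha hb => simp only [map_add, LinearMap.add_apply, ha, hb]
  | single t c =>
    induction y using Finsupp.induction_linear with
    | zero => simp
    | add a b ha hb => simp only [map_add, ha, hb]
    | single t' c' =>
      have e : ∀ (t : Index μ) (c : ℚ), toWords (Finsupp.single t c) = c • indexWord t := by
        intro t c; simp [toWords]
      simp only [e, map_smul, LinearMap.smul_apply, main]

end Shuffle

/-! ### Finite multiple `L`-values -/

/-- `∑_{0 < n₁ < ⋯ < n_r < M} η₁^{n₁} η₂^{n₂ - n₁} ⋯ η_r^{n_r - n_{r-1}} / (n₁^{k₁} ⋯ n_r^{k_r})`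
in a commutative ring in which `1, …, M - 1` are invertible; `χ` says how the `ηᵢ` are read in that
ring. In the term of index `i`, `Fin.cons 0 n i.castSucc` is `n_{i-1}`, with `n₀ = 0`. -/
def truncL {A μ : Type} [CommRing A] [Monoid μ] (χ : μ →* A) (M : ℕ) (t : Index μ) : A :=
  ∑ n ∈ (Fintype.piFinset fun _ : Fin t.length => Finset.Ioo 0 M) with StrictMono n,
    ∏ i : Fin t.length,
      χ (t.get i).1 ^ (n i - (Fin.cons 0 n : Fin (t.length + 1) → ℕ) i.castSucc) *
        Ring.inverse (n i : A) ^ ((t.get i).2 : ℕ)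

section LValues

variable (N : ℕ) [NeZero N] (α : ZMod N) (ζ : rootsOfUnity N ℂ) (hζ : IsPrimitiveRoot ζ N)

/-- A root of unity as an element of `lim R / pⁿ R`. -/
def muPAdic (p : ℕ) : rootsOfUnity N ℂ →* PAdic N p :=
  (algebraMap (CycRing N) (PAdic N p)).toMonoidHom.comp
    ((Units.coeHom (CycRing N)).comp (muHom N ζ hζ))

/-- The `𝐩`-adic finite multiple `L`-value of a tuple. -/
def LHat (t : Index (rootsOfUnity N ℂ)) : AHat N α :=
  proj N α fun p => truncL (muPAdic N ζ hζ p.1) p.1 t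

/-- The `ℚ`-linear extension of the `𝐩`-adic finite multiple `L`-values. -/
def LHatLin : IndexSpace (rootsOfUnity N ℂ) →ₗ[ℚ] AHat N α :=
  Finsupp.linearCombination ℚ (LHat N α ζ hζ)

/-- `η^𝐩 = π((η^p)ₚ)`. -/
def powBigPrime (η : rootsOfUnity N ℂ) : AHat N α :=
  proj N α fun p => muPAdic N ζ hζ p.1 η ^ p.1

end LValues

/-- The tuple
`(η₁/ξ₁, …, η_r/ξ₁, 1/ξ₁, ξ_s/ξ₁, …, ξ₂/ξ₁; k₁, …, k_r, l_s + f_s, …, l₁ + f₁)`. The column that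
contains `l_j + f_j` has the color `ξ_{j+1}/ξ₁`, where `ξ_{s+1} = 1`. -/
def reflectedIndex {μ : Type} [Group μ] {r s : ℕ} (η : Fin r → μ) (k : Fin r → ℕ+)
    (ξ : Fin (s + 1) → μ) (l : Fin (s + 1) → ℕ+) (f : Fin (s + 1) → ℕ) : Index μ :=
  (List.ofFn fun i => (η i / ξ 0, k i)) ++
    List.reverse (List.ofFn fun j : Fin (s + 1) =>
      (((Fin.snoc (fun i : Fin s => ξ i.succ) 1 : Fin (s + 1) → μ) j / ξ 0,
        ⟨l j + f j, Nat.add_pos_left (l j).pos _⟩) : μ × ℕ+))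

end FiniteMLV

end

/-! The truncated `L`-value of a word is the sum of the coefficients of degree `< p` of a power
series, the formal iterated integral `wordSeries`. Modulo `X ^ p` these series multiply according to
the shuffle product: with `1, …, p - 1` invertible, a series without constant term is determined
below degree `p` by `X · d/dX` of it, and Leibniz's rule for this operator is the recursion of the
shuffle product (`X_pow_dvd_shuffle_sub_mul`). Hence the `L`-value of a shuffle is a sum over pairs
of chains, one ending at `i` and the other at `j`, with `i + j < p` (`sum_truncL_shuffle`).

Reflecting the second chain by `q ↦ p - q` turns the condition into `i < p - j`, so the two chains
join into a single chain below `p`. The weights of the second part become `1 / (p - q)^l`, its order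
is reversed, and each color moves to the neighboring gap. The gap from the last member up to `p`
carries `ξ₁` but does not occur in an `L`-value; since all gaps add up to `p`, extracting `ξ₁^p` and
dividing every color by `ξ₁` removes it (`chainCoeff_div`, `chainSum_reflectList`).

In `R / pⁿ R` the element `p` is nilpotent, so `1 / (p - q)^l` is a finite negative binomial sum in
`p / q` (`inverse_sub_pow`); expanding every reflected weight gives the right-hand side exactly, for
every prime and every `n` (`sum_truncL_shuffle_eq`). At level `n` only the exponents `f` with all
`fᵢ < n` contribute, which yields unconditional convergence in the projective limit
(`hasSum_hat_of_eval`). -/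

noncomputable section

namespace FiniteMLV

open PowerSeries

section Algebra

variable {A μ : Type}

/-! ### Reflected lists of weights -/

/-- The weights `(x / y, g₁(M - ·)), (x₁ / y, g₂(M - ·)), …` for a list `(x₁, g₁), (x₂, g₂), …`. -/
def reflectList [Group μ] (M : ℕ) (y : μ) : μ → List (μ × (ℕ → A)) → List (μ × (ℕ → A))
  | _, [] => []
  | x, c :: L => (x / y, fun q => c.2 (M - q)) :: reflectList M y c.1 L

/-- Matches the recursive color shift with the `Fin.snoc` form used in `reflectedIndex`. The initial
color `x` stays general because it becomes the color of the entry just removed in the induction. -/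
theorem reflectList_reverse_ofFn [Group μ] (M : ℕ) (y x : μ) {s : ℕ} (ξ : Fin (s + 1) → μ)
    (g : Fin (s + 1) → ℕ → A) :
    reflectList M y x (List.ofFn fun j => (ξ j, g j)).reverse =
      (List.ofFn fun j : Fin (s + 1) =>
        ((Fin.snoc (fun i : Fin s => ξ i.succ) x : Fin (s + 1) → μ) j / y,
          fun q => g j (M - q))).reverse := by
  induction s generalizing x with
  | zero => simp [reflectList, Fin.snoc]
  | succ s ih =>
    rw [List.ofFn_succ_last (f := fun j => (ξ j, g j))]
    simp only [List.reverse_append, List.reverse_cons, List.reverse_nil, List.nil_append,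
      List.cons_append, reflectList]
    rw [ih (ξ (Fin.last _)) (fun j => ξ j.castSucc) (fun j => g j.castSucc),
      List.ofFn_succ_last (n := s + 1)]
    simp only [List.reverse_append, List.reverse_cons, List.reverse_nil, List.nil_append,
      List.cons_append, Fin.snoc_last]
    congr 3
    funext j
    rw [Fin.snoc_castSucc]
    congr 2
    refine Fin.lastCases ?_ (fun j => ?_) j
    · rw [Fin.snoc_last]; rfl
    · rw [Fin.snoc_castSucc]; rfl

variable [CommRing A]

/-! ### The words in a shuffle product -/

/-- The shuffles of two words, all given by the lists of their letters from the last one to the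
first one. -/
def shuffleList {D : Type} : List D → List D → List (List D)
  | [], v => [v]
  | z :: u, [] => [z :: u]
  | z :: u, z' :: v =>
      (shuffleList (z :: u) v).map (z' :: ·) ++ (shuffleList u (z' :: v)).map (z :: ·)
  termination_by u v => u.length + v.length

theorem shuffleRev_eq_sum {D : Type} (u v : List D) :
    shuffleRev u v =
      ((shuffleList u v).map fun w => (w.reverse.map (FreeAlgebra.ι ℚ)).prod).sum := by
  induction u, v using shuffleList.induct with
  | case1 v => simp [shuffleRev, shuffleList]
  | case2 z u => simp [shuffleRev, shuffleList]
  | case3 z u z' v ih1 ih2 =>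
    rw [shuffleRev, shuffleList, ih1, ih2, List.map_append, List.sum_append, List.map_map,
      List.map_map, ← List.sum_map_mul_right, ← List.sum_map_mul_right]
    simp [Function.comp_def]

/-- Words are stored backwards, so `getLast?` is the first letter, and a shuffle begins with the
first letter of one of its factors. The clause on empty words keeps the induction going: a letter
added to an empty word would become its first letter. -/
theorem getLast?_of_mem_shuffleList {D : Type} {z₀ : D} {u v w : List D}
    (hu : u.getLast? ≠ some z₀) (hv : v.getLast? ≠ some z₀) (hw : w ∈ shuffleList u v) :
    w.getLast? ≠ some z₀ ∧ (w = [] → u = [] ∧ v = []) := by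
  have tl : ∀ (z : D) u, (z :: u).getLast? ≠ some z₀ → u.getLast? ≠ some z₀ := by
    rintro z (_ | ⟨b, u⟩) h
    · simp
    · simpa using h
  have step : ∀ (z : D) (w : List D), w ≠ [] → w.getLast? ≠ some z₀ →
      (z :: w).getLast? ≠ some z₀ := by
    rintro z (_ | ⟨b, u⟩) h h'
    · exact absurd rfl h
    · simpa using h'
  induction u, v using shuffleList.induct generalizing w with
  | case1 v => simp only [shuffleList, List.mem_singleton] at hw; subst hw; exact ⟨hv, by simp⟩
  | case2 z u => simp only [shuffleList, List.mem_singleton] at hw; subst hw; exact ⟨hu, by simp⟩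
  | case3 z u z' v ih1 ih2 =>
    simp only [shuffleList, List.mem_append, List.mem_map] at hw
    rcases hw with ⟨w, hw, rfl⟩ | ⟨w, hw, rfl⟩
    · obtain ⟨h1, h2⟩ := ih1 hu (tl _ _ hv) hw
      exact ⟨step _ _ (fun h => by simpa using h2 h) h1, by simp⟩
    · obtain ⟨h1, h2⟩ := ih2 (tl _ _ hu) hv hw
      exact ⟨step _ _ (fun h => by simpa using h2 h) h1, by simp⟩

theorem parse_fst_eq_zero {w : List (WithZero μ)} (hw : w.head? ≠ some 0) : (parse w).1 = 0 := by
  have h := indexLetters_parse w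
  by_contra hne
  obtain ⟨n, hn⟩ := Nat.exists_eq_succ_of_ne_zero hne
  rw [hn, List.replicate_succ, List.cons_append] at h
  rw [← h] at hw
  simp at hw

theorem getLast?_reverse_indexLetters (t : Index μ) :
    (indexLetters t).reverse.getLast? ≠ some 0 := by
  rcases t with _ | ⟨c, t⟩ <;> simp [indexLetters]

theorem parse_fst_of_mem_shuffleList {t t' : Index μ} {w : List (WithZero μ)}
    (hw : w ∈ shuffleList (indexLetters t).reverse (indexLetters t').reverse) :
    (parse w.reverse).1 = 0 := by
  refine parse_fst_eq_zero ?_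
  rw [List.head?_reverse]
  exact (getLast?_of_mem_shuffleList (getLast?_reverse_indexLetters t)
    (getLast?_reverse_indexLetters t') hw).1

section Monoid

variable [Monoid μ] (χ : μ →* A)

/-! ### Iterated sums along increasing chains -/

/-- The sum of `∏ᵢ χ(xᵢ)^(nᵢ - nᵢ₋₁) gᵢ(nᵢ)` over the chains `a = n₀ < n₁ < ⋯ < n_r < M`. -/
def chainSum (M : ℕ) : List (μ × (ℕ → A)) → ℕ → A
  | [], _ => 1
  | c :: L, a => ∑ n ∈ Finset.Ioo a M, χ c.1 ^ (n - a) * c.2 n * chainSum M L n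

/-- The sum of `∏ᵢ χ(xᵢ)^(nᵢ - nᵢ₋₁) gᵢ(nᵢ)` over the chains `0 = n₀ < n₁ < ⋯ < n_r = n`, for the
list of the pairs `(xᵢ, gᵢ)` from the last one to the first one. -/
def chainCoeff : List (μ × (ℕ → A)) → ℕ → A
  | [], n => if n = 0 then 1 else 0
  | c :: L, n => c.2 n * ∑ m ∈ Finset.range n, χ c.1 ^ (n - m) * chainCoeff L m

/-- The column `(x, k)` as the weight `n ↦ n⁻ᵏ` of color `x`. -/
def columnWeight (c : μ × ℕ+) : μ × (ℕ → A) := (c.1, fun n => Ring.inverse (n : A) ^ (c.2 : ℕ))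

/-- Splitting off the smallest member of a chain replaces the lower end `0` by that member, so the
induction needs an arbitrary lower end `a`. -/
theorem sum_strictMono_eq_chainSum (M : ℕ) (t : Index μ) (a : ℕ) :
    ∑ n ∈ (Fintype.piFinset fun _ : Fin t.length => Finset.Ioo a M) with StrictMono n,
      ∏ i : Fin t.length,
        χ (t.get i).1 ^ (n i - (Fin.cons a n : Fin (t.length + 1) → ℕ) i.castSucc) *
          Ring.inverse (n i : A) ^ ((t.get i).2 : ℕ) =
      chainSum χ M (t.map columnWeight) a := by
  induction t generalizing a with
  | nil =>
    have : (Finset.filter (fun n : Fin ([] : Index μ).length → ℕ => StrictMono n)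
        (Fintype.piFinset fun _ => Finset.Ioo a M)) = {fun i => i.elim0} := by
      ext n
      simp only [Finset.mem_filter, Fintype.mem_piFinset, Finset.mem_singleton]
      exact ⟨fun _ => funext fun i => i.elim0, fun _ => ⟨fun i => i.elim0, fun i => i.elim0⟩⟩
    rw [this, Finset.sum_singleton]
    rfl
  | cons c t ih =>
    simp only [List.map_cons, chainSum, ← ih, Finset.mul_sum]
    rw [Finset.sum_sigma']
    symm
    refine Finset.sum_bij' (fun x _ => (Fin.cons x.1 x.2 : Fin (t.length + 1) → ℕ))
      (fun n _ => ⟨n 0, fun i => n i.succ⟩) ?_ ?_ ?_ ?_ ?_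
    · rintro ⟨n, m⟩ h
      simp only [Finset.mem_sigma, Finset.mem_filter, Fintype.mem_piFinset, Finset.mem_Ioo] at h ⊢
      refine ⟨fun i => ?_, ?_⟩
      · refine Fin.cases ?_ (fun i => ?_) i
        · exact h.1
        · exact ⟨h.1.1.trans (h.2.1 i).1, (h.2.1 i).2⟩
      · intro i j
        refine Fin.cases ?_ (fun j => ?_) j
        · intro hij; exact absurd hij (Fin.not_lt_zero i)
        · refine Fin.cases ?_ (fun i => ?_) i
          · intro _; exact (h.2.1 j).1
          · intro hij; exact h.2.2 (Fin.succ_lt_succ_iff.1 hij)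
    · intro n h
      simp only [Finset.mem_sigma, Finset.mem_filter, Fintype.mem_piFinset, Finset.mem_Ioo] at h ⊢
      exact ⟨h.1 0, fun i => ⟨h.2 (Fin.succ_pos i), (h.1 i.succ).2⟩,
        h.2.comp (Fin.strictMono_succ)⟩
    · rintro ⟨n, m⟩ h
      rfl
    · intro n h
      exact Fin.cons_self_tail n
    · rintro ⟨n, m⟩ h
      refine Eq.trans ?_ (Fin.prod_univ_succ _).symm
      rfl

theorem truncL_eq_chainSum (M : ℕ) (t : Index μ) :
    truncL χ M t = chainSum χ M (t.map columnWeight) 0 :=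
  sum_strictMono_eq_chainSum χ M t 0

/-- Both sides sum over the same chains, cut at two consecutive members `i < n`; exchanging the two
summations moves the cut. -/
theorem sum_chainCoeff_mul_chainSum_cons (M : ℕ) (c : μ × (ℕ → A)) (L R : List (μ × (ℕ → A))) :
    ∑ i ∈ Finset.range M, chainCoeff χ L i * chainSum χ M (c :: R) i =
      ∑ n ∈ Finset.range M, chainCoeff χ (c :: L) n * chainSum χ M R n := by
  simp only [chainSum, chainCoeff, Finset.mul_sum, Finset.sum_mul]
  rw [Finset.sum_sigma', Finset.sum_sigma']
  refine Finset.sum_bij' (fun x _ => ⟨x.2, x.1⟩) (fun x _ => ⟨x.2, x.1⟩) ?_ ?_ ?_ ?_ ?_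
  · rintro ⟨i, n⟩ h
    simp only [Finset.mem_sigma, Finset.mem_range, Finset.mem_Ioo] at h ⊢
    omega
  · rintro ⟨i, n⟩ h
    simp only [Finset.mem_sigma, Finset.mem_range, Finset.mem_Ioo] at h ⊢
    omega
  · intros; rfl
  · intros; rfl
  · rintro ⟨i, n⟩ h
    ring

theorem sum_chainCoeff_mul_chainSum_append (M : ℕ) (P L R : List (μ × (ℕ → A))) :
    ∑ i ∈ Finset.range M, chainCoeff χ L i * chainSum χ M (P ++ R) i =
      ∑ n ∈ Finset.range M, chainCoeff χ (P.reverse ++ L) n * chainSum χ M R n := by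
  induction P generalizing L with
  | nil => rfl
  | cons c P ih =>
    rw [List.cons_append, sum_chainCoeff_mul_chainSum_cons, ih]
    simp

theorem chainSum_append {M : ℕ} (hM : 0 < M) (P R : List (μ × (ℕ → A))) :
    chainSum χ M (P ++ R) 0 =
      ∑ n ∈ Finset.range M, chainCoeff χ P.reverse n * chainSum χ M R n := by
  have h := sum_chainCoeff_mul_chainSum_append χ M P [] R
  rw [List.append_nil] at h
  -- Before the first member the only possible cut is at `0`, as `chainCoeff` of the empty list is
  -- the indicator of `0`.
  rw [← h, Finset.sum_eq_single 0]
  · simp [chainCoeff]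
  · intro b _ hb; simp [chainCoeff, hb]
  · intro h; simp [hM.ne'] at h

theorem truncL_eq_sum_chainCoeff {M : ℕ} (hM : 0 < M) (t : Index μ) :
    truncL χ M t = ∑ n ∈ Finset.range M, chainCoeff χ (t.reverse.map columnWeight) n := by
  have h := chainSum_append χ hM (t.map columnWeight) []
  simpa [truncL_eq_chainSum, chainSum] using h

/-! ### Linearity of the chain sums in each weight -/

theorem chainSum_sum_weight {κ : Type} (M : ℕ) (x : μ) (T : Finset κ) (h : κ → ℕ → A)
    (P S : List (μ × (ℕ → A))) (a : ℕ) :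
    chainSum χ M (P ++ (x, fun n => ∑ j ∈ T, h j n) :: S) a =
      ∑ j ∈ T, chainSum χ M (P ++ (x, h j) :: S) a := by
  induction P generalizing a with
  | nil =>
    simp only [List.nil_append, chainSum, Finset.mul_sum, Finset.sum_mul]
    exact Finset.sum_comm
  | cons c P ih =>
    simp only [List.cons_append, chainSum, ih, Finset.mul_sum]
    exact Finset.sum_comm

theorem chainSum_mul_weight (M : ℕ) (x : μ) (b : A) (h : ℕ → A)
    (P S : List (μ × (ℕ → A))) (a : ℕ) :
    chainSum χ M (P ++ (x, fun n => b * h n) :: S) a =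
      b * chainSum χ M (P ++ (x, h) :: S) a := by
  induction P generalizing a with
  | nil =>
    simp only [List.nil_append, chainSum, Finset.mul_sum]
    exact Finset.sum_congr rfl fun n _ => by ring
  | cons c P ih =>
    simp only [List.cons_append, chainSum, ih, Finset.mul_sum]
    exact Finset.sum_congr rfl fun n _ => by ring

/-- Only the weights at `0 < n < M` enter, which is exactly where the expansion of the reflected
weights is valid. -/
theorem chainSum_congr (M : ℕ) {L L' : List (μ × (ℕ → A))}
    (h : List.Forall₂ (fun c c' => c.1 = c'.1 ∧ ∀ n, 0 < n → n < M → c.2 n = c'.2 n) L L') (a : ℕ) :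
    chainSum χ M L a = chainSum χ M L' a := by
  induction h generalizing a with
  | nil => rfl
  | cons hc _ ih =>
    refine Finset.sum_congr rfl fun n hn => ?_
    rw [Finset.mem_Ioo] at hn
    rw [hc.1, hc.2 n (by omega) hn.2, ih]

theorem sum_piFinset_fin_succ {s : ℕ} (T : Finset ℕ) (F : (Fin (s + 1) → ℕ) → A) :
    ∑ f ∈ Fintype.piFinset fun _ : Fin (s + 1) => T, F f =
      ∑ j ∈ T, ∑ f ∈ Fintype.piFinset fun _ : Fin s => T, F (Fin.cons j f) := by
  rw [← Finset.sum_product']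
  refine Finset.sum_bij' (fun f _ => (f 0, Fin.tail f)) (fun x _ => Fin.cons x.1 x.2) ?_ ?_ ?_ ?_ ?_
  · intro f hf
    simp only [Fintype.mem_piFinset, Finset.mem_product] at hf ⊢
    exact ⟨hf 0, fun i => hf i.succ⟩
  · intro x hx
    simp only [Fintype.mem_piFinset, Finset.mem_product] at hx ⊢
    exact Fin.cases hx.1 hx.2
  · intro f _; exact Fin.cons_self_tail f
  · intro x _; rfl
  · intro f _; exact congrArg F (Fin.cons_self_tail f).symm

/-- Multilinearity of the chain sum in a whole block of weights; the block will be the reflected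
one. -/
theorem chainSum_expand (M : ℕ) {s : ℕ} (T : Finset ℕ) (x : Fin s → μ) (b : Fin s → ℕ → A)
    (h : Fin s → ℕ → ℕ → A) (P S : List (μ × (ℕ → A))) (a : ℕ) :
    chainSum χ M (P ++ ((List.ofFn fun j => (x j, fun n => ∑ f ∈ T, b j f * h j f n)).reverse ++ S))
        a =
      ∑ f ∈ Fintype.piFinset fun _ : Fin s => T, (∏ j, b j (f j)) *
        chainSum χ M (P ++ ((List.ofFn fun j => (x j, h j (f j))).reverse ++ S)) a := by
  induction s generalizing S with
  | zero => simp
  | succ s ih =>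
    rw [sum_piFinset_fin_succ]
    simp only [List.ofFn_succ, List.reverse_cons, List.append_assoc, List.cons_append,
      List.nil_append, Fin.prod_univ_succ, Fin.cons_zero, Fin.cons_succ]
    -- The block is reversed, so its entry of index `0` stands at the end and is absorbed into the
    -- suffix `S` when the induction hypothesis is applied.
    rw [ih, Finset.sum_comm]
    refine Finset.sum_congr rfl fun f _ => ?_
    rw [← List.append_assoc, chainSum_sum_weight, Finset.mul_sum]
    refine Finset.sum_congr rfl fun j _ => ?_
    rw [chainSum_mul_weight, List.append_assoc]
    ring

/-! ### The power series of a word -/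

/-- The power series `x · ω_z` for the differential forms `ω_0 = dx/x`, `ω_y = y dx/(1 - y x)`. -/
def letterSeries : WithZero μ → A⟦X⟧
  | none => 1
  | some y => mk fun n => if n = 0 then 0 else χ y ^ n

/-- The iterated integral, as a formal power series, of a word given by the list of its letters from
the last one to the first one. -/
def wordSeries : List (WithZero μ) → A⟦X⟧
  | [] => 1
  | z :: u => mk fun n => Ring.inverse (n : A) * coeff n (wordSeries u * letterSeries χ z)

theorem coeff_mul_letterSeries_coe (F : A⟦X⟧) (y : μ) (n : ℕ) :
    coeff n (F * letterSeries χ (y : WithZero μ)) =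
      ∑ m ∈ Finset.range n, χ y ^ (n - m) * coeff m F := by
  change coeff n (F * mk fun n => if n = 0 then 0 else χ y ^ n) = _
  rw [coeff_mul, Finset.Nat.sum_antidiagonal_eq_sum_range_succ_mk, Finset.sum_range_succ]
  simp only [coeff_mk, Nat.sub_self, if_true, mul_zero, add_zero]
  refine Finset.sum_congr rfl fun m hm => ?_
  rw [Finset.mem_range] at hm
  rw [if_neg (by omega), mul_comm]

theorem coeff_wordSeries_replicate (m : ℕ) (u : List (WithZero μ)) (n : ℕ) :
    coeff n (wordSeries χ (List.replicate m 0 ++ u)) =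
      Ring.inverse (n : A) ^ m * coeff n (wordSeries χ u) := by
  induction m with
  | zero => simp
  | succ m ih =>
    rw [List.replicate_succ, List.cons_append, wordSeries, coeff_mk]
    change _ * coeff n (_ * 1) = _
    rw [mul_one, ih, pow_succ]
    ring

/-- In degree `n`, a letter `e_y` convolves with the powers of `χ y` and divides by `n`, and each of
the following `k - 1` letters `e_0` divides by `n` again: the block contributes one chain member
with weight `1 / n^k`. -/
theorem coeff_wordSeries_indexLetters (t : Index μ) (n : ℕ) :
    coeff n (wordSeries χ (indexLetters t).reverse) =
      chainCoeff χ (t.reverse.map columnWeight) n := by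
  induction t using List.reverseRecOn generalizing n with
  | nil => simp [indexLetters, wordSeries, chainCoeff, coeff_one]
  | append_singleton t c ih =>
    have e : (indexLetters (t ++ [c])).reverse =
        List.replicate ((c.2 : ℕ) - 1) 0 ++ ((c.1 : WithZero μ) :: (indexLetters t).reverse) := by
      simp [indexLetters]
    have hc : Ring.inverse (n : A) ^ (c.2 : ℕ) =
        Ring.inverse (n : A) ^ ((c.2 : ℕ) - 1) * Ring.inverse (n : A) := by
      rw [← pow_succ, Nat.sub_add_cancel c.2.pos]
    rw [e, coeff_wordSeries_replicate, wordSeries, coeff_mk, coeff_mul_letterSeries_coe]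
    simp only [ih, List.reverse_append, List.reverse_cons, List.reverse_nil, List.nil_append,
      List.cons_append, List.map_cons, chainCoeff, columnWeight, hc, mul_assoc]

theorem truncL_eq_sum_coeff {M : ℕ} (hM : 0 < M) (t : Index μ) :
    truncL χ M t =
      ∑ n ∈ Finset.range M, coeff n (wordSeries χ (indexLetters t).reverse) := by
  simp only [truncL_eq_sum_chainCoeff χ hM, coeff_wordSeries_indexLetters]

/-! ### The shuffle product as a product of power series -/

theorem coeff_zero_wordSeries_cons (z : WithZero μ) (u : List (WithZero μ)) :
    coeff 0 (wordSeries χ (z :: u)) = 0 := by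
  rw [wordSeries, coeff_mk, Nat.cast_zero, Ring.inverse_zero, zero_mul]

theorem coeff_X_mul_derivative (F : A⟦X⟧) (n : ℕ) :
    coeff n (X * derivative A F) = n * coeff n F := by
  cases n with
  | zero => simp
  | succ n => rw [coeff_succ_X_mul, coeff_derivative]; push_cast; ring

/-- The differential equation of an iterated integral, truncated to the degrees where `n` can be
inverted. In degree `0` it would fail for the single letter `e_0`, whose right-hand side is `1`;
hence the condition on the first letter. -/
theorem X_pow_dvd_derivative_wordSeries {M : ℕ} (hM : ∀ n, 0 < n → n < M → IsUnit (n : A))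
    (z : WithZero μ) (u : List (WithZero μ)) (h : (z :: u).getLast? ≠ some 0) :
    (X : A⟦X⟧) ^ M ∣
      X * derivative A (wordSeries χ (z :: u)) - wordSeries χ u * letterSeries χ z := by
  rw [X_pow_dvd_iff]
  intro n hn
  rw [map_sub, coeff_X_mul_derivative, sub_eq_zero]
  rcases Nat.eq_zero_or_pos n with rfl | h0
  · rw [Nat.cast_zero, zero_mul]
    cases z with
    | zero =>
      cases u with
      | nil => simp at h
      | cons b u =>
        change 0 = coeff 0 (_ * 1)
        rw [mul_one, coeff_zero_wordSeries_cons]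
    | coe y => simp [coeff_mul_letterSeries_coe]
  · rw [wordSeries, coeff_mk, Ring.mul_inverse_cancel_left _ _ (hM n h0 hn)]

theorem X_pow_dvd_of_derivative {M : ℕ} (hM : ∀ n, 0 < n → n < M → IsUnit (n : A))
    {F : A⟦X⟧} (h0 : coeff 0 F = 0) (h : X ^ M ∣ X * derivative A F) : X ^ M ∣ F := by
  rw [X_pow_dvd_iff] at h ⊢
  intro n hn
  rcases Nat.eq_zero_or_pos n with rfl | hpos
  · exact h0
  · have := h n hn
    rw [coeff_X_mul_derivative] at this
    exact (hM n hpos hn).mul_right_eq_zero.1 this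

/-- For nonempty words both sides have zero constant term and, by Leibniz's rule and induction on
the shorter pairs, the same image under `X · d/dX` modulo `X ^ M`. -/
theorem X_pow_dvd_shuffle_sub_mul {M : ℕ} (hM : ∀ n, 0 < n → n < M → IsUnit (n : A))
    (u v : List (WithZero μ)) (hu : u.getLast? ≠ some 0) (hv : v.getLast? ≠ some 0) :
    (X : A⟦X⟧) ^ M ∣
      ((shuffleList u v).map (wordSeries χ)).sum - wordSeries χ u * wordSeries χ v := by
  have tl : ∀ (z : WithZero μ) u, (z :: u).getLast? ≠ some 0 → u.getLast? ≠ some 0 := by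
    rintro z (_ | ⟨b, u⟩) h
    · simp
    · simpa using h
  have key : ∀ (z : WithZero μ) (W : List (List (WithZero μ))),
      (∀ w ∈ W, (z :: w).getLast? ≠ some 0) →
      (X : A⟦X⟧) ^ M ∣ X * derivative A ((W.map fun w => wordSeries χ (z :: w)).sum) -
        (W.map (wordSeries χ)).sum * letterSeries χ z := by
    intro z W hW
    induction W with
    | nil => simp
    | cons w W ih =>
      have h1 := X_pow_dvd_derivative_wordSeries χ hM z w (hW w (by simp))
      have h2 := ih fun w hw => hW w (by simp [hw])
      simp only [List.map_cons, List.sum_cons, map_add]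
      convert dvd_add h1 h2 using 1
      ring
  induction u, v using shuffleList.induct with
  | case1 v => simp [shuffleList, wordSeries]
  | case2 z u => simp [shuffleList, wordSeries]
  | case3 z u z' v ih1 ih2 =>
    refine X_pow_dvd_of_derivative hM ?_ ?_
    · have h0 : ∀ (z : WithZero μ) (W : List (List (WithZero μ))),
          coeff 0 ((W.map fun w => wordSeries χ (z :: w)).sum) = 0 := by
        intro z W
        induction W with
        | nil => simp
        | cons w W ih =>
          rw [List.map_cons, List.sum_cons, map_add, ih, coeff_zero_wordSeries_cons, add_zero]
      rw [shuffleList, List.map_append, List.sum_append, List.map_map, List.map_map, map_sub,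
        map_add]
      simp only [Function.comp_def]
      rw [h0, h0, coeff_mul, Finset.Nat.antidiagonal_zero, Finset.sum_singleton,
        coeff_zero_wordSeries_cons]
      simp
    · have hw1 : ∀ w ∈ shuffleList (z :: u) v, (z' :: w).getLast? ≠ some 0 := by
        intro w hw
        refine (getLast?_of_mem_shuffleList hu hv (w := z' :: w) ?_).1
        simp [shuffleList, hw]
      have hw2 : ∀ w ∈ shuffleList u (z' :: v), (z :: w).getLast? ≠ some 0 := by
        intro w hw
        refine (getLast?_of_mem_shuffleList hu hv (w := z :: w) ?_).1
        simp [shuffleList, hw]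
      have k1 := key z' _ hw1
      have k2 := key z _ hw2
      have d1 := X_pow_dvd_derivative_wordSeries χ hM z u hu
      have d2 := X_pow_dvd_derivative_wordSeries χ hM z' v hv
      have i1 := ih1 hu (tl _ _ hv)
      have i2 := ih2 (tl _ _ hu) hv
      rw [shuffleList, List.map_append, List.sum_append, List.map_map, List.map_map]
      simp only [Function.comp_def, map_sub, map_add, Derivation.leibniz, smul_eq_mul]
      obtain ⟨a1, k1⟩ := k1
      obtain ⟨a2, k2⟩ := k2
      obtain ⟨a3, d1⟩ := d1
      obtain ⟨a4, d2⟩ := d2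
      obtain ⟨a5, i1⟩ := i1
      obtain ⟨a6, i2⟩ := i2
      refine ⟨a1 + a2 + a5 * letterSeries χ z' + a6 * letterSeries χ z
        - a4 * wordSeries χ (z :: u) - a3 * wordSeries χ (z' :: v), ?_⟩
      linear_combination k1 + k2 + letterSeries χ z' * i1 + letterSeries χ z * i2
        - wordSeries χ (z :: u) * d2 - wordSeries χ (z' :: v) * d1

/-- Summing the coefficients of a product in degrees `< M` is summing over the triangle `i + j < M`.
-/
theorem sum_coeff_shuffle {M : ℕ} (hM : ∀ n, 0 < n → n < M → IsUnit (n : A))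
    (u v : List (WithZero μ)) (hu : u.getLast? ≠ some 0) (hv : v.getLast? ≠ some 0) :
    ((shuffleList u v).map fun w => ∑ n ∈ Finset.range M, coeff n (wordSeries χ w)).sum =
      ∑ i ∈ Finset.range M, coeff i (wordSeries χ u) *
        ∑ j ∈ Finset.range (M - i), coeff j (wordSeries χ v) := by
  have h := X_pow_dvd_iff.1 (X_pow_dvd_shuffle_sub_mul χ hM u v hu hv)
  have e : ∀ W : List (List (WithZero μ)),
      (W.map fun w => ∑ n ∈ Finset.range M, coeff n (wordSeries χ w)).sum =
        ∑ n ∈ Finset.range M, coeff n ((W.map (wordSeries χ)).sum) := by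
    intro W
    induction W with
    | nil => simp
    | cons w W ih => simp [ih, Finset.sum_add_distrib]
  rw [e]
  have h' : ∀ n ∈ Finset.range M, coeff n ((shuffleList u v).map (wordSeries χ)).sum =
      coeff n (wordSeries χ u * wordSeries χ v) := by
    intro n hn
    exact sub_eq_zero.1 (by rw [← map_sub]; exact h n (Finset.mem_range.1 hn))
  rw [Finset.sum_congr rfl h']
  simp only [coeff_mul, Finset.mul_sum, Finset.Nat.sum_antidiagonal_eq_sum_range_succ_mk]
  rw [Finset.sum_sigma', Finset.sum_sigma']
  refine Finset.sum_bij' (fun x _ => ⟨x.2, x.1 - x.2⟩) (fun x _ => ⟨x.1 + x.2, x.1⟩) ?_ ?_ ?_ ?_ ?_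
  · rintro ⟨i, n⟩ h
    simp only [Finset.mem_sigma, Finset.mem_range] at h ⊢
    omega
  · rintro ⟨i, n⟩ h
    simp only [Finset.mem_sigma, Finset.mem_range] at h ⊢
    omega
  · rintro ⟨i, n⟩ h
    simp only [Finset.mem_sigma, Finset.mem_range] at h ⊢
    congr 1
    omega
  · rintro ⟨i, n⟩ h
    simp only [Finset.mem_sigma, Finset.mem_range] at h ⊢
    congr 1
    omega
  · rintro ⟨i, n⟩ h
    rfl

theorem sum_truncL_shuffle {M : ℕ} (h0 : 0 < M) (hM : ∀ n, 0 < n → n < M → IsUnit (n : A))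
    (t t' : Index μ) :
    ((shuffleList (indexLetters t).reverse (indexLetters t').reverse).map fun w =>
        truncL χ M (parse w.reverse).2).sum =
      ∑ i ∈ Finset.range M, chainCoeff χ (t.reverse.map columnWeight) i *
        ∑ j ∈ Finset.range (M - i), chainCoeff χ (t'.reverse.map columnWeight) j := by
  simp only [← coeff_wordSeries_indexLetters]
  rw [← sum_coeff_shuffle χ hM _ _ (getLast?_reverse_indexLetters t)
    (getLast?_reverse_indexLetters t')]
  refine congrArg List.sum (List.map_congr_left fun w hw => ?_)
  have h := indexLetters_parse w.reverse
  rw [parse_fst_of_mem_shuffleList hw, List.replicate_zero, List.nil_append] at h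
  rw [truncL_eq_sum_coeff χ h0, h, List.reverse_reverse]

/-- Invertibility of `1, …, M - 1` is essential: a ring homomorphism need not respect the default
value `0` of `Ring.inverse` at a nonunit. -/
theorem map_truncL {B : Type} [CommRing B] (φ : A →+* B) {M : ℕ}
    (hM : ∀ n, 0 < n → n < M → IsUnit (n : A)) (t : Index μ) :
    φ (truncL χ M t) = truncL ((φ : A →* B).comp χ) M t := by
  rw [truncL, truncL, map_sum]
  refine Finset.sum_congr rfl fun n hn => ?_
  rw [map_prod]
  refine Finset.prod_congr rfl fun i _ => ?_
  have hi := Finset.mem_Ioo.1 (Fintype.mem_piFinset.1 (Finset.mem_filter.1 hn).1 i)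
  obtain ⟨x, hx⟩ := hM _ hi.1 hi.2
  have e : φ (Ring.inverse (n i : A)) = Ring.inverse (n i : B) := by
    rw [← map_natCast φ, ← hx, Ring.inverse_unit]
    exact (Ring.inverse_unit (x.map (φ : A →* B))).symm
  rw [map_mul, map_pow, map_pow, e]
  rfl

/-! ### Expansion of the reflected weights -/

/-- Pascal's rule for the truncated series of `(1 - y)^(-(d + 2))`, with its boundary term, which
vanishes once `y ^ n = 0`. -/
theorem one_sub_mul_sum_choose (y : A) (d n : ℕ) :
    (1 - y) * ∑ f ∈ Finset.range n, ((d + 1 + f).choose f : A) * y ^ f =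
      ∑ f ∈ Finset.range n, ((d + f).choose f : A) * y ^ f -
        ((d + n).choose (d + 1) : A) * y ^ n := by
  induction n with
  | zero => simp
  | succ n ih =>
    have h1 : (d + 1 + n).choose n = (d + n).choose n + (d + n).choose (d + 1) := by
      rw [← Nat.choose_symm_add, ← Nat.choose_symm_add (a := d), show d + 1 + n = (d + n) + 1 by ring,
        Nat.choose_succ_succ]
    have h2 : (d + (n + 1)).choose (d + 1) = (d + 1 + n).choose n := by
      rw [← Nat.choose_symm_add, show d + (n + 1) = d + 1 + n by ring]
    rw [Finset.sum_range_succ, Finset.sum_range_succ, mul_add, ih, h2, h1]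
    push_cast
    ring

theorem one_sub_pow_mul_sum_choose {y : A} {n : ℕ} (hy : y ^ n = 0) (d : ℕ) :
    (1 - y) ^ (d + 1) * ∑ f ∈ Finset.range n, ((d + f).choose f : A) * y ^ f = 1 := by
  induction d with
  | zero =>
    have := mul_neg_geom_sum y n
    simpa [hy] using this
  | succ d ih =>
    rw [pow_succ, mul_assoc, one_sub_mul_sum_choose, hy, mul_zero, sub_zero, ih]

theorem inverse_sub_pow {p n q : ℕ} (hp : (p : A) ^ n = 0)
    (hM : ∀ m, 0 < m → m < p → IsUnit (m : A)) (h0 : 0 < q) (hq : q < p) (l : ℕ+) :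
    Ring.inverse ((p - q : ℕ) : A) ^ (l : ℕ) =
      ∑ f ∈ Finset.range n, ((-1) ^ (l : ℕ) * ((l + f - 1).choose f : A) * (p : A) ^ f) *
        Ring.inverse (q : A) ^ (l + f : ℕ) := by
  obtain ⟨d, hd⟩ : ∃ d, (l : ℕ) = d + 1 := ⟨l - 1, by have := l.pos; omega⟩
  have hu := hM q h0 hq
  have hv := hM (p - q) (by omega) (by omega)
  have hi : (q : A) * Ring.inverse (q : A) = 1 := Ring.mul_inverse_cancel _ hu
  have hj : ((p - q : ℕ) : A) * Ring.inverse ((p - q : ℕ) : A) = 1 := Ring.mul_inverse_cancel _ hv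
  have hc : ((p - q : ℕ) : A) = p - q := Nat.cast_sub hq.le
  generalize Ring.inverse ((p - q : ℕ) : A) = v at hj ⊢
  generalize Ring.inverse (q : A) = w at hi ⊢
  rw [hc] at hj
  have hs := one_sub_pow_mul_sum_choose (y := (p : A) * w) (n := n) (by rw [mul_pow, hp, zero_mul]) d
  have e : ∑ f ∈ Finset.range n, ((-1) ^ (l : ℕ) * ((l + f - 1).choose f : A) * (p : A) ^ f) *
        w ^ (l + f : ℕ) = (-1) ^ (l : ℕ) * w ^ (l : ℕ) *
          ∑ f ∈ Finset.range n, ((d + f).choose f : A) * ((p : A) * w) ^ f := by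
    rw [Finset.mul_sum]
    refine Finset.sum_congr rfl fun f _ => ?_
    rw [hd, show d + 1 + f - 1 = d + f by omega, pow_add w, mul_pow]
    ring
  -- This is `1 / (p - q) = -(1 / q) / (1 - p / q)`, freed of denominators.
  have hw : v * (1 - p * w) = -w := by linear_combination (-w) * hj - v * hi
  rw [e, hd, ← mul_pow, neg_one_mul, ← hw, mul_pow, mul_assoc, hs, mul_one]

end Monoid

/-! ### Reflection -/

section Group

variable [Group μ] (χ : μ →* A)

/-- The gaps of a chain from `0` to `n` add up to `n`, so dividing all colors by `y` costs exactly
`χ y ^ n`. -/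
theorem chainCoeff_div (y : μ) (L : List (μ × (ℕ → A))) (n : ℕ) :
    χ y ^ n * chainCoeff χ (L.map fun c => (c.1 / y, c.2)) n = chainCoeff χ L n := by
  induction L generalizing n with
  | nil => by_cases h : n = 0 <;> simp [chainCoeff, h]
  | cons c L ih =>
    simp only [List.map_cons, chainCoeff, Finset.mul_sum]
    refine Finset.sum_congr rfl fun m hm => ?_
    rw [Finset.mem_range] at hm
    have hy : χ y * χ (c.1 / y) = χ c.1 := by rw [mul_comm, ← map_mul, div_mul_cancel]
    rw [← ih, ← hy, mul_pow]
    have : χ y ^ n = χ y ^ (n - m) * χ y ^ m := by rw [← pow_add, Nat.sub_add_cancel hm.le]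
    rw [this]
    ring

/-- Reverse the chain by `q = M - j`. The gap above `a` gets the color `x`, and the top gap, ending
at `M`, gets the last color of `L`, which is `y` by `h`. All gaps add up to `M - a`, so after
extracting `χ y ^ (M - a)` the top gap has color `1` and disappears. -/
theorem chainSum_reflectList {M : ℕ} (y x : μ) (L : List (μ × (ℕ → A)))
    (h : ((L.map Prod.fst).getLast?).getD x = y) {a : ℕ} (ha : a < M) :
    χ y ^ (M - a) * chainSum χ M (reflectList M y x L) a =
      ∑ j ∈ Finset.range (M - a), χ x ^ (M - a - j) * chainCoeff χ L j := by
  induction L generalizing x a with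
  | nil =>
    simp only [List.map_nil, List.getLast?_nil, Option.getD_none] at h
    subst h
    rw [Finset.sum_eq_single 0]
    · simp [chainSum, chainCoeff, reflectList]
    · intro b _ hb; simp [chainCoeff, hb]
    · intro h; simp at h; omega
  | cons c L ih =>
    have h' : ((L.map Prod.fst).getLast?).getD c.1 = y := by
      rw [← h, List.map_cons, List.getLast?_cons, Option.getD_some]
    have hs : ∑ j ∈ Finset.range (M - a), χ x ^ (M - a - j) * chainCoeff χ (c :: L) j =
        ∑ q ∈ Finset.Ioo a M, χ x ^ (q - a) * chainCoeff χ (c :: L) (M - q) := by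
      have : Finset.range (M - a) = insert 0 (Finset.Ioo 0 (M - a)) := by
        ext i
        simp only [Finset.mem_range, Finset.mem_insert, Finset.mem_Ioo]
        omega
      -- A nonempty chain cannot end at `0`, so the term `j = 0` vanishes.
      rw [this, Finset.sum_insert (by simp)]
      simp only [chainCoeff, Finset.range_zero, Finset.sum_empty, mul_zero, zero_add]
      refine Finset.sum_bij' (fun j _ => M - j) (fun q _ => M - q) ?_ ?_ ?_ ?_ ?_
      · intro j hj; simp only [Finset.mem_Ioo] at hj ⊢; omega
      · intro j hj; simp only [Finset.mem_Ioo] at hj ⊢; omega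
      · intro j hj; simp only [Finset.mem_Ioo] at hj ⊢; omega
      · intro j hj; simp only [Finset.mem_Ioo] at hj ⊢; omega
      · intro j hj
        simp only [Finset.mem_Ioo] at hj
        rw [show M - j - a = M - a - j by omega, show M - (M - j) = j by omega]
    rw [hs, reflectList, chainSum, Finset.mul_sum]
    refine Finset.sum_congr rfl fun q hq => ?_
    rw [Finset.mem_Ioo] at hq
    have hy : χ y * χ (x / y) = χ x := by rw [mul_comm, ← map_mul, div_mul_cancel]
    rw [chainCoeff, ← ih c.1 h' hq.2, ← hy, mul_pow,
      show χ y ^ (M - a) = χ y ^ (q - a) * χ y ^ (M - q) by rw [← pow_add]; congr 1; omega]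
    ring

theorem sum_truncL_shuffle_eq {p n : ℕ} (h0 : 0 < p) (hp : (p : A) ^ n = 0)
    (hM : ∀ m, 0 < m → m < p → IsUnit (m : A)) {r s : ℕ} (η : Fin r → μ) (k : Fin r → ℕ+)
    (ξ : Fin (s + 1) → μ) (l : Fin (s + 1) → ℕ+) :
    ((shuffleList (indexLetters (List.ofFn fun i => (η i, k i))).reverse
        (indexLetters (List.ofFn fun j => (ξ j, l j))).reverse).map fun w =>
          truncL χ p (parse w.reverse).2).sum =
      (-1) ^ (∑ i, (l i : ℕ)) * χ (ξ 0) ^ p *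
        ∑ f ∈ Fintype.piFinset fun _ : Fin (s + 1) => Finset.range n,
          (∏ i, ((l i + f i - 1).choose (f i) : A)) *
            truncL χ p (reflectedIndex η k ξ l f) * (p : A) ^ ∑ i, f i := by
  rw [sum_truncL_shuffle χ h0 hM]
  have hL : List.map columnWeight (List.ofFn fun j => (ξ j, l j)).reverse =
      (List.ofFn fun j => (ξ j, fun n : ℕ => Ring.inverse (n : A) ^ (l j : ℕ))).reverse := by
    rw [List.map_reverse, List.map_ofFn]; rfl
  have hlast : (((List.map columnWeight (List.ofFn fun j => (ξ j, l j)).reverse :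
      List (μ × (ℕ → A))).map Prod.fst).getLast?).getD 1 = ξ 0 := by
    simp [List.ofFn_succ, columnWeight]
  -- The sum over `j` has no factor for the gap `p - i - j`, so its color is `1`; this is the origin
  -- of the column of color `1 / ξ₁`.
  have hin : ∀ i ∈ Finset.range p, ∑ j ∈ Finset.range (p - i),
      chainCoeff χ (List.map columnWeight (List.ofFn fun j => (ξ j, l j)).reverse) j =
      χ (ξ 0) ^ (p - i) * chainSum χ p (reflectList p (ξ 0) 1
        (List.map columnWeight (List.ofFn fun j => (ξ j, l j)).reverse)) i := by
    intro i hi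
    rw [chainSum_reflectList χ (ξ 0) 1 _ hlast (Finset.mem_range.1 hi)]
    simp
  have hexp : chainSum χ p (((List.ofFn fun i => (η i, k i)).map columnWeight).map
        (fun c => (c.1 / ξ 0, c.2)) ++ reflectList p (ξ 0) 1
        (List.map columnWeight (List.ofFn fun j => (ξ j, l j)).reverse)) 0 =
      (-1) ^ (∑ i, (l i : ℕ)) * ∑ f ∈ Fintype.piFinset fun _ : Fin (s + 1) => Finset.range n,
          (∏ i, ((l i + f i - 1).choose (f i) : A)) *
            truncL χ p (reflectedIndex η k ξ l f) * (p : A) ^ ∑ i, f i := by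
    rw [hL, reflectList_reverse_ofFn]
    have := chainSum_expand χ p (Finset.range n)
      (fun j => (Fin.snoc (fun i : Fin s => ξ i.succ) 1 : Fin (s + 1) → μ) j / ξ 0)
      (fun j f => (-1) ^ (l j : ℕ) * ((l j + f - 1).choose f : A) * (p : A) ^ f)
      (fun j f q => Ring.inverse (q : A) ^ (l j + f : ℕ))
      (((List.ofFn fun i => (η i, k i)).map columnWeight).map (fun c => (c.1 / ξ 0, c.2))) [] 0
    simp only [List.append_nil] at this
    refine (chainSum_congr χ p ?_ 0).trans (this.trans ?_)
    · refine List.rel_append (List.forall₂_same.2 fun c _ => ⟨rfl, fun _ _ _ => rfl⟩) ?_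
      refine List.rel_reverse ?_
      rw [List.forall₂_iff_get]
      refine ⟨by simp, fun i h1 h2 => ?_⟩
      simp only [List.get_eq_getElem, List.getElem_ofFn, true_and]
      intro q hq hq'
      exact inverse_sub_pow hp hM hq hq' _
    · rw [Finset.mul_sum]
      refine Finset.sum_congr rfl fun f _ => ?_
      have e : truncL χ p (reflectedIndex η k ξ l f) = chainSum χ p
          (((List.ofFn fun i => (η i, k i)).map columnWeight).map (fun c => (c.1 / ξ 0, c.2)) ++
          (List.ofFn fun j : Fin (s + 1) =>
            ((Fin.snoc (fun i : Fin s => ξ i.succ) 1 : Fin (s + 1) → μ) j / ξ 0,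
              fun q : ℕ => Ring.inverse (q : A) ^ (l j + f j : ℕ))).reverse) 0 := by
        rw [truncL_eq_chainSum, reflectedIndex, List.map_append, List.map_reverse, List.map_ofFn,
          List.map_ofFn, List.map_ofFn, List.map_ofFn]
        rfl
      rw [e, Finset.prod_mul_distrib, Finset.prod_mul_distrib, Finset.prod_pow_eq_pow_sum,
        Finset.prod_pow_eq_pow_sum]
      ring
  rw [mul_assoc, mul_left_comm, ← hexp, chainSum_append χ h0, Finset.mul_sum]
  refine Finset.sum_congr rfl fun i hi => ?_
  rw [hin i hi, ← List.map_reverse, ← List.map_reverse]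
  rw [← chainCoeff_div χ (ξ 0) (List.map columnWeight (List.ofFn fun i => (η i, k i)).reverse)]
  -- The power `p - i` belongs to the reflected part above `i`, the power `i` to the part below it.
  rw [show χ (ξ 0) ^ p = χ (ξ 0) ^ (p - i) * χ (ξ 0) ^ i by
    rw [← pow_add, Nat.sub_add_cancel (Finset.mem_range.1 hi).le]]
  ring

end Group

end Algebra

end FiniteMLV

end

noncomputable section

namespace FiniteMLV

/-! ### Passage from the levels `R / pⁿ R` to `𝒜̂(N;α)`. -/

section Hat

variable (N : ℕ) (α : ZMod N)

/-- The projection of `𝒜̂(N;α)` onto `𝒜ₙ(N;α)`. -/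
def hatEval (n : ℕ+) : AHat N α →+* AdelicLevel (primeFamily N α) n :=
  (Pi.evalRingHom _ n).comp (AdelicHat (primeFamily N α)).subtype

/-- The topology is induced from a product, so sums can be tested at each level, where the series
has only finitely many nonzero terms. -/
theorem hasSum_hat_of_eval {κ : Type} (F : κ → AHat N α) (S : AHat N α) (T : ℕ+ → Finset κ)
    (h0 : ∀ n, ∀ f ∉ T n, hatEval N α n (F f) = 0)
    (hS : ∀ n, hatEval N α n S = ∑ f ∈ T n, hatEval N α n (F f)) : HasSum F S := by
  refine (Topology.IsInducing.subtypeVal.hasSum_iff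
    (g := (AdelicHat (primeFamily N α)).subtype) F S).1 (Pi.hasSum.2 fun n => ?_)
  change HasSum (fun f => hatEval N α n (F f)) (hatEval N α n S)
  rw [hS n]
  exact hasSum_sum_of_ne_finset_zero (h0 n)

theorem isUnit_natCast_padic_of_lt {p : ℕ} (hp : p.Prime) (m : ℕ) (h0 : 0 < m) (hm : m < p) :
    IsUnit (m : PAdic N p) :=
  isUnit_natCast_padic N p m ((Nat.coprime_of_lt_prime h0.ne' hm hp).symm)

theorem isUnit_natCast_level (n : ℕ+) (p : PrimesMod N α) (m : ℕ) (h0 : 0 < m) (hm : m < p.1) :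
    IsUnit (m : CycRing N ⧸ Ideal.span {primeFamily N α p} ^ (n : ℕ)) := by
  have := (isUnit_natCast_padic_of_lt N p.2.1 m h0 hm).map
    (AdicCompletion.evalₐ (Ideal.span {(p.1 : CycRing N)}) (n : ℕ))
  simpa using this

theorem natCast_pow_level (n : ℕ+) (p : PrimesMod N α) :
    (p.1 : CycRing N ⧸ Ideal.span {primeFamily N α p} ^ (n : ℕ)) ^ (n : ℕ) = 0 := by
  have : Ideal.Quotient.mk (Ideal.span {primeFamily N α p} ^ (n : ℕ))
      ((p.1 : CycRing N) ^ (n : ℕ)) = 0 :=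
    Ideal.Quotient.eq_zero_iff_mem.2 (Ideal.pow_mem_pow (Ideal.mem_span_singleton_self _) _)
  simpa using this

theorem hatEval_bigPrime (n : ℕ+) :
    hatEval N α n (bigPrime N α) = levelMk _ n fun p => (p.1 : CycRing N ⧸ _) := by
  refine congrArg (levelMk _ n) (funext fun p => ?_)
  exact map_natCast (AdicCompletion.evalₐ (Ideal.span {(p.1 : CycRing N)}) (n : ℕ)).toRingHom _

theorem hatEval_bigPrime_pow_eq_zero (n : ℕ+) {m : ℕ} (h : (n : ℕ) ≤ m) :
    hatEval N α n (bigPrime N α) ^ m = 0 := by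
  refine pow_eq_zero_of_le h ?_
  rw [hatEval_bigPrime, ← map_pow, ← map_zero (levelMk _ n)]
  exact congrArg _ (funext fun p => natCast_pow_level N α n p)

variable [NeZero N] (ζ : rootsOfUnity N ℂ) (hζ : IsPrimitiveRoot ζ N)

/-- A root of unity as an element of `R / pⁿ R`. -/
def muLevel (n : ℕ+) (p : PrimesMod N α) :
    rootsOfUnity N ℂ →* CycRing N ⧸ Ideal.span {primeFamily N α p} ^ (n : ℕ) :=
  (((AdicCompletion.evalₐ (Ideal.span {(p.1 : CycRing N)}) (n : ℕ)).toRingHom :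
    PAdic N p.1 →+* _) : PAdic N p.1 →* _).comp (muPAdic N ζ hζ p.1)

theorem hatEval_LHat (n : ℕ+) (t : Index (rootsOfUnity N ℂ)) :
    hatEval N α n (LHat N α ζ hζ t) =
      levelMk _ n fun p => truncL (muLevel N α ζ hζ n p) p.1 t := by
  refine congrArg (levelMk _ n) (funext fun p => ?_)
  exact map_truncL _ (AdicCompletion.evalₐ (Ideal.span {(p.1 : CycRing N)}) (n : ℕ)).toRingHom
    (isUnit_natCast_padic_of_lt N p.2.1) t

theorem hatEval_powBigPrime (n : ℕ+) (x : rootsOfUnity N ℂ) :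
    hatEval N α n (powBigPrime N α ζ hζ x) =
      levelMk _ n fun p => muLevel N α ζ hζ n p x ^ p.1 := by
  refine congrArg (levelMk _ n) (funext fun p => ?_)
  exact map_pow (AdicCompletion.evalₐ (Ideal.span {(p.1 : CycRing N)}) (n : ℕ)).toRingHom
    (muPAdic N ζ hζ p.1 x) p.1

/-- No word of the shuffle begins with `e_0`, so `ofWords` kills none of them. -/
theorem LHatLin_indexShuffle (t t' : Index (rootsOfUnity N ℂ)) :
    LHatLin N α ζ hζ (indexShuffle (Finsupp.single t 1) (Finsupp.single t' 1)) =
      ((shuffleList (indexLetters t).reverse (indexLetters t').reverse).map fun w =>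
        LHat N α ζ hζ (parse w.reverse).2).sum := by
  have e : ∀ t : Index (rootsOfUnity N ℂ), toWords (Finsupp.single t 1) =
      ((indexLetters t).map (FreeAlgebra.ι ℚ)).prod := by
    intro t; simp [toWords, indexWord_eq]
  rw [indexShuffle, e, e, shuffle_words, shuffleRev_eq_sum, map_list_sum, map_list_sum,
    List.map_map, List.map_map]
  refine congrArg List.sum (List.map_congr_left fun w hw => ?_)
  simp only [Function.comp_apply]
  rw [← wordBasis_apply, ofWords, Module.Basis.constr_basis, FreeMonoid.toList_ofList,
    if_pos (parse_fst_of_mem_shuffleList hw), LHatLin, Finsupp.linearCombination_single, one_smul]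

theorem powBigPrime_mul_inv (x : rootsOfUnity N ℂ) :
    powBigPrime N α ζ hζ x * powBigPrime N α ζ hζ x⁻¹ = 1 := by
  rw [powBigPrime, powBigPrime, ← map_mul, ← map_one (proj N α)]
  refine congrArg _ (funext fun p => ?_)
  rw [Pi.mul_apply, Pi.one_apply, ← mul_pow, ← map_mul, mul_inv_cancel, map_one, one_pow]

/-- The identity in `R / pⁿ R` holds for every prime of the family, so it passes to the classes of
families. -/
theorem hatEval_LHatLin_indexShuffle {r s : ℕ} (k : Fin r → ℕ+) (l : Fin (s + 1) → ℕ+)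
    (η : Fin r → rootsOfUnity N ℂ) (ξ : Fin (s + 1) → rootsOfUnity N ℂ) (n : ℕ+) :
    hatEval N α n (LHatLin N α ζ hζ (indexShuffle
        (Finsupp.single (List.ofFn fun i => (η i, k i)) 1)
        (Finsupp.single (List.ofFn fun j => (ξ j, l j)) 1))) =
      (-1) ^ (∑ i, (l i : ℕ)) * hatEval N α n (powBigPrime N α ζ hζ (ξ 0)) *
        ∑ f ∈ Fintype.piFinset fun _ : Fin (s + 1) => Finset.range n,
          hatEval N α n ((∏ i, ((l i + f i - 1).choose (f i) : AHat N α)) *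
            LHat N α ζ hζ (reflectedIndex η k ξ l f) * bigPrime N α ^ ∑ i, f i) := by
  rw [LHatLin_indexShuffle, map_list_sum, List.map_map]
  simp only [Function.comp_def, hatEval_LHat, map_mul, map_prod, map_pow, map_natCast,
    hatEval_bigPrime, hatEval_powBigPrime]
  have e1 : ∀ W : List (List (WithZero (rootsOfUnity N ℂ))), (W.map fun w =>
      levelMk (primeFamily N α) n fun p =>
        truncL (muLevel N α ζ hζ n p) p.1 (parse w.reverse).2).sum =
      levelMk (primeFamily N α) n fun p => (W.map fun w =>
        truncL (muLevel N α ζ hζ n p) p.1 (parse w.reverse).2).sum := by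
    intro W
    induction W with
    | nil => exact (map_zero _).symm
    | cons w W ih =>
      rw [List.map_cons, List.sum_cons, ih, ← map_add]
      exact congrArg _ (funext fun p => by simp)
  rw [e1]
  have e2 : ∀ p : PrimesMod N α, _ := fun p =>
    sum_truncL_shuffle_eq (muLevel N α ζ hζ n p) p.2.1.pos (natCast_pow_level N α n p)
      (isUnit_natCast_level N α n p) η k ξ l
  simp only [e2]
  have e3 : ∀ m : ℕ, (m : AdelicLevel (primeFamily N α) n) = levelMk (primeFamily N α) n m :=
    fun m => (map_natCast _ m).symm
  have e4 : (-1 : AdelicLevel (primeFamily N α) n) = levelMk (primeFamily N α) n (-1) := by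
    rw [map_neg, map_one]
  simp only [e3, e4, ← map_pow, ← map_mul, ← map_prod, ← map_sum]
  refine congrArg _ (funext fun p => ?_)
  simp

/-- The sign and `ξ₁^𝐩` are units; moving them to the other side gives the value of the bare series,
hence summability as well. -/
theorem hasSum_LHat_reflectedIndex {r s : ℕ} (k : Fin r → ℕ+) (l : Fin (s + 1) → ℕ+)
    (η : Fin r → rootsOfUnity N ℂ) (ξ : Fin (s + 1) → rootsOfUnity N ℂ) :
    HasSum (fun f : Fin (s + 1) → ℕ =>
      (∏ i, ((l i + f i - 1).choose (f i) : AHat N α)) *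
        LHat N α ζ hζ (reflectedIndex η k ξ l f) * bigPrime N α ^ ∑ i, f i)
      ((-1) ^ (∑ i, (l i : ℕ)) * powBigPrime N α ζ hζ (ξ 0)⁻¹ *
        LHatLin N α ζ hζ (indexShuffle
          (Finsupp.single (List.ofFn fun i => (η i, k i)) 1)
          (Finsupp.single (List.ofFn fun j => (ξ j, l j)) 1))) := by
  refine hasSum_hat_of_eval N α _ _
    (fun n => Fintype.piFinset fun _ : Fin (s + 1) => Finset.range n) (fun n f hf => ?_)
    (fun n => ?_)
  · simp only [Fintype.mem_piFinset, Finset.mem_range, not_forall, not_lt] at hf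
    obtain ⟨i, hi⟩ := hf
    rw [map_mul, map_pow, hatEval_bigPrime_pow_eq_zero, mul_zero]
    exact hi.trans (Finset.single_le_sum (f := f) (fun _ _ => Nat.zero_le _) (Finset.mem_univ i))
  · rw [map_mul, hatEval_LHatLin_indexShuffle, map_mul, map_pow, map_neg, map_one]
    have h1 := congrArg (hatEval N α n) (powBigPrime_mul_inv N α ζ hζ (ξ 0))
    rw [map_mul, map_one] at h1
    have h2 : ((-1 : AdelicLevel (primeFamily N α) n) ^ (∑ i, (l i : ℕ))) *
        (-1) ^ (∑ i, (l i : ℕ)) = 1 := by rw [← mul_pow]; simp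
    have key : ∀ c d e S : AdelicLevel (primeFamily N α) n, c * c = 1 → d * e = 1 →
        c * e * (c * d * S) = S := by
      intro c d e S hc hd
      linear_combination (c * c * S) * hd + S * hc
    exact key _ _ _ _ h2 h1

end Hat

end FiniteMLV

end

/-! ### The reflection formula. -/

theorem mainTheorem4 (N : ℕ) [NeZero N] (α : ZMod N)
    (ζ : rootsOfUnity N ℂ) (hζ : IsPrimitiveRoot ζ N)
    (r s : ℕ) (k : Fin r → ℕ+) (l : Fin (s + 1) → ℕ+)
    (η : Fin r → rootsOfUnity N ℂ) (ξ : Fin (s + 1) → rootsOfUnity N ℂ) :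
    Summable (fun f : Fin (s + 1) → ℕ =>
      (∏ i, ((l i + f i - 1).choose (f i) : FiniteMLV.AHat N α)) *
        FiniteMLV.LHat N α ζ hζ (FiniteMLV.reflectedIndex η k ξ l f) *
        FiniteMLV.bigPrime N α ^ ∑ i, f i) ∧
    FiniteMLV.LHatLin N α ζ hζ
        (FiniteMLV.indexShuffle
          (Finsupp.single (List.ofFn fun i => (η i, k i)) 1)
          (Finsupp.single (List.ofFn fun j => (ξ j, l j)) 1)) =
      (-1) ^ (∑ i, (l i : ℕ)) * FiniteMLV.powBigPrime N α ζ hζ (ξ 0) *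
        ∑' f : Fin (s + 1) → ℕ,
          (∏ i, ((l i + f i - 1).choose (f i) : FiniteMLV.AHat N α)) *
            FiniteMLV.LHat N α ζ hζ (FiniteMLV.reflectedIndex η k ξ l f) *
            FiniteMLV.bigPrime N α ^ ∑ i, f i := by
  have h := FiniteMLV.hasSum_LHat_reflectedIndex N α ζ hζ k l η ξ
  refine ⟨h.summable, ?_⟩
  rw [h.tsum_eq]
  have h1 := FiniteMLV.powBigPrime_mul_inv N α ζ hζ (ξ 0)
  have h2 : ((-1 : FiniteMLV.AHat N α) ^ (∑ i, (l i : ℕ))) * (-1) ^ (∑ i, (l i : ℕ)) = 1 := by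
    rw [← mul_pow]; simp
  generalize (-1 : FiniteMLV.AHat N α) ^ (∑ i, (l i : ℕ)) = c at h2 ⊢
  generalize FiniteMLV.LHatLin N α ζ hζ _ = S
  linear_combination (-(c * c * S)) * h1 - S * h2
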